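/- Let $\mathrm{Vec}\,\mathbb R := \mathbb C[x]\partial_x$ be the complex Lie algebra of polynomial vector fields on the line, with basis $e_n := x^{n+1}\partial_x$, $n \ge -1$, and let $\mathfrak U$ be its universal enveloping algebra. For a representation $\pi$ of $\mathrm{Vec}\,\mathbb R$ on a complex vector space $V$, let $\mathrm{Ann}(V) \subset \mathfrak U$ be the kernel of the extension of $\pi$ to $\mathfrak U$. For $\lambda \in \mathbb C$, let $\mathcal F_\lambda = dx^\lambda\,\mathbb C[x]$ be the tensor density module, with action $$\pi_\lambda(f\partial_x)(dx^\lambda g) = dx^\lambda (f g' + \lambda f' g),$$ and, for a central indeterminate $\Lambda$, let $\mathcal F_\Lambda = dx^\Lambda\,\mathbb C[\Lambda, x]$ be the universal tensor density module, with action $\pi_\Lambda(f\partial_x)(dx^\Lambda g) = dx^\Lambda (f g' + \Lambda f' g)$, where $'$ denotes the derivative with respect to $x$. Set $$Q^{e_2} := 3e_1^2 - 2e_2(2e_0+1) + e_3e_{-1} \in \mathfrak U,$$ and let $\langle Q^{e_2}\rangle$ be the two-sided ideal of $\mathfrak U$ generated by $Q^{e_2}$. **Theorem.** $$\bigcap_{\lambda\in\mathbb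 C} \mathrm{Ann}(\mathcal F_\lambda) = \mathrm{Ann}(\mathcal F_\Lambda) = \langle Q^{e_2}\rangle.$$ -/

import Mathlib

noncomputable section

open Polynomial

namespace VecLine

attribute [local instance 100] LieRing.ofAssociativeRing

/-- The annihilator of a representation `π : L → End(V)` of a Lie algebra: the kernel of its
extension to the universal enveloping algebra, as a two-sided ideal. -/
def annihilator {R L V : Type*} [CommRing R] [LieRing L] [LieAlgebra R L]
    [AddCommGroup V] [Module R V] (π : L →ₗ⁅R⁆ Module.End R V) :
    TwoSidedIdeal (UniversalEnvelopingAlgebra R L) :=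
  TwoSidedIdeal.ker (UniversalEnvelopingAlgebra.lift R π)

/-- The Lie algebra `ℂ[x] ∂ₓ` of polynomial vector fields on the line, as the Lie algebra of
derivations of `ℂ[x]`. -/
abbrev Vec : Type := Derivation ℂ ℂ[X] ℂ[X]

/-- The vector field `f ∂ₓ`. -/
def field (f : ℂ[X]) : Vec := Polynomial.mkDerivation ℂ f

/-- The coefficient `f` of a vector field `f ∂ₓ`. -/
def coeff : Vec →ₗ[ℂ] ℂ[X] where
  toFun D := D X
  map_add' _ _ := rfl
  map_smul' _ _ := rfl

/-- Applying `f ∂ₓ` to a polynomial `g` gives `f g'`. -/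
theorem field_apply (f g : ℂ[X]) : field f g = f * derivative g := by
  simp [field, Polynomial.mkDerivation_apply, mul_comm]

theorem coeff_field (f : ℂ[X]) : coeff (field f) = f := by
  simp [coeff, field_apply]

/-- Every derivation of `ℂ[x]` is a polynomial vector field. -/
theorem field_coeff (D : Vec) : field (coeff D) = D := by
  apply Polynomial.derivation_ext
  simp [coeff, field_apply]

/-- The bracket of vector fields: `[f ∂ₓ, g ∂ₓ] = (f g' - g f') ∂ₓ`. -/
theorem coeff_lie (D E : Vec) :
    coeff ⁅D, E⁆ = coeff D * derivative (coeff E) - coeff E * derivative (coeff D) := by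
  conv_lhs => rw [← field_coeff D, ← field_coeff E]
  simp [coeff, Derivation.commutator_apply, field_apply]

/-- The monomial vector field `e n = x ^ (n + 1) ∂ₓ`, to be used for `n ≥ -1`. -/
def e (n : ℤ) : Vec := field (X ^ (n + 1).toNat)

/-- The tensor density representation `π_lam` of `Vec` on `𝓕_lam = dx^lam ℂ[x]`, where
`dx^lam g` is written as `g`:  `π_lam (f ∂ₓ) g = f g' + lam f' g`. -/
def tensorDensity (lam : ℂ) : Vec →ₗ⁅ℂ⁆ Module.End ℂ ℂ[X] where
  toFun D :=
    LinearMap.mulLeft ℂ (coeff D) ∘ₗ derivative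
      + lam • LinearMap.mulLeft ℂ (derivative (coeff D))
  map_add' D E := by
    apply LinearMap.ext; intro g
    simp [Polynomial.smul_eq_C_mul]; ring
  map_smul' c D := by
    apply LinearMap.ext; intro g
    simp [Polynomial.smul_eq_C_mul]; ring
  map_lie' {D E} := by
    apply LinearMap.ext; intro g
    simp only [coeff_lie, Ring.lie_def, LinearMap.add_apply, LinearMap.sub_apply,
      LinearMap.comp_apply, LinearMap.mulLeft_apply, LinearMap.smul_apply, Module.End.mul_apply,
      derivative_mul, map_add, map_sub, Polynomial.smul_eq_C_mul, derivative_C]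
    ring

theorem tensorDensity_field (lam : ℂ) (f g : ℂ[X]) :
    tensorDensity lam (field f) g = f * derivative g + lam • (derivative f * g) := by
  simp [tensorDensity, coeff_field]

/-- The inclusion `ℂ[x] → ℂ[Λ][x]`; the inner variable of `ℂ[X][X]` plays the role of `Λ` and
the outer one that of `x`. -/
def incl : ℂ[X] →ₐ[ℂ] ℂ[X][X] := Polynomial.mapAlgHom (Algebra.ofId ℂ ℂ[X])

theorem derivative_incl (f : ℂ[X]) : derivative (incl f) = incl (derivative f) := by
  simp [incl, Polynomial.derivative_map]

/-- The partial derivative `∂ₓ` on `ℂ[Λ][x]`, as a `ℂ`-linear map. -/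
def partialX : Module.End ℂ ℂ[X][X] := (derivative (R := ℂ[X])).restrictScalars ℂ

/-- The universal tensor density representation of `Vec` on `𝓕_Λ = dx^Λ ℂ[Λ, x]`, where `dx^Λ g`
is written as `g`:  `π_Λ (f ∂ₓ) g = f g' + Λ f' g`, with `'` the derivative in `x`. -/
def universalTensorDensity : Vec →ₗ⁅ℂ⁆ Module.End ℂ ℂ[X][X] where
  toFun D :=
    LinearMap.mulLeft ℂ (incl (coeff D)) ∘ₗ partialX
      + LinearMap.mulLeft ℂ (C X * incl (derivative (coeff D)))
  map_add' D E := by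
    apply LinearMap.ext; intro g
    simp; ring
  map_smul' c D := by
    apply LinearMap.ext; intro g
    simp [smul_add, mul_assoc]
  map_lie' {D E} := by
    apply LinearMap.ext; intro g
    simp only [coeff_lie, Ring.lie_def, LinearMap.add_apply, LinearMap.sub_apply,
      LinearMap.comp_apply, LinearMap.mulLeft_apply, Module.End.mul_apply, partialX,
      LinearMap.coe_restrictScalars, ← derivative_incl,
      derivative_mul, map_add, map_sub, map_mul, derivative_C]
    ring

theorem universalTensorDensity_field (f : ℂ[X]) (g : ℂ[X][X]) :
    universalTensorDensity (field f) g =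
      incl f * derivative g + C X * incl (derivative f) * g := by
  change incl (coeff (field f)) * derivative g + C X * incl (derivative (coeff (field f))) * g = _
  rw [coeff_field]

/-- The element `Q^{e₂} = 3 e₁² - 2 e₂ (2 e₀ + 1) + e₃ e₋₁` of `𝔘(Vec)`. -/
def Qe2 : UniversalEnvelopingAlgebra ℂ Vec :=
  let u : ℤ → UniversalEnvelopingAlgebra ℂ Vec := fun n => UniversalEnvelopingAlgebra.ι ℂ (e n)
  3 * u 1 ^ 2 - 2 * u 2 * (2 * u 0 + 1) + u 3 * u (-1)

end VecLine

end

noncomputable section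

open Polynomial

namespace VecLine

attribute [local instance 100] LieRing.ofAssociativeRing

/-! Easy half: `Qe2` kills `𝓕_Λ` by direct computation (`universalAct_Qe2`), and setting `Λ = lam`
maps `𝓕_Λ` equivariantly onto each `𝓕_lam`, so `⟨Qe2⟩ ⊆ Ann(𝓕_Λ) ⊆ ⋂ Ann(𝓕_lam)`. It remains to
close the cycle.

Modulo `⟨Qe2⟩`, any product `e n * e m` with `n, m ≥ 1` can be rewritten with only one factor of
positive index: `Qe2` is the relation `quadRel 1 1`, and brackets with `e 1` and `e 2` produce every
`quadRel n m` (`quadRel_mem`). Hence the quotient is spanned by the monomials `lead n * p (e 0) * e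
(-1) ^ i` (`standardSpan_eq_top`). A combination of these that acts by zero on `𝓕_lam` for every
`lam` has all coefficients `p` zero (`eq_zero_of_act_normalForm_eq_zero`). So an element of every
annihilator has normal form zero, hence lies in `⟨Qe2⟩`. The Poincaré–Birkhoff–Witt theorem is not
needed. -/

/-- The universal enveloping algebra of the polynomial vector fields on the line. -/
abbrev 𝔘 : Type := UniversalEnvelopingAlgebra ℂ Vec

/-- The generator `e n` inside the enveloping algebra. -/
def u (n : ℤ) : 𝔘 := UniversalEnvelopingAlgebra.ι ℂ (e n)

theorem coeff_injective : Function.Injective coeff := fun D E h => by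
  rw [← field_coeff D, ← field_coeff E, h]

theorem lie_e {n m : ℤ} (hn : -1 ≤ n) (hm : -1 ≤ m) :
    ⁅e n, e m⁆ = ((m - n : ℤ) : ℂ) • e (n + m) := by
  apply coeff_injective
  rw [coeff_lie, map_smul]
  simp only [e, coeff_field]
  obtain ⟨a, rfl⟩ : ∃ a : ℕ, n = a - 1 := ⟨(n + 1).toNat, by omega⟩
  obtain ⟨b, rfl⟩ : ∃ b : ℕ, m = b - 1 := ⟨(m + 1).toNat, by omega⟩
  -- Truncation occurs only for `n = m = -1`, where the coefficient `m - n` vanishes.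
  have h : ((a : ℤ) - 1 + (b - 1) + 1).toNat = a + b - 1 := by omega
  simp only [h, sub_add_cancel, Int.toNat_natCast, derivative_X_pow, smul_eq_C_mul]
  rcases a with _ | a <;> rcases b with _ | b <;> simp <;> ring

theorem lie_u {n m : ℤ} (hn : -1 ≤ n) (hm : -1 ≤ m) :
    ⁅u n, u m⁆ = ((m - n : ℤ) : ℂ) • u (n + m) := by
  simp only [u, ← LieHom.map_lie, lie_e hn hm, map_smul]

/-! ### Quadratic relations and their brackets -/

/-- The quadratic relation between `e n * e m`, `e (n + m) * e 0` and `e (n + m + 1) * e (-1)`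
satisfied in all tensor density modules. -/
def quadRel (n m : ℤ) : 𝔘 :=
  ((n + m + 1 : ℤ) : ℂ) • (u n * u m) - ((n + m + 1 + n * m : ℤ) : ℂ) • (u (n + m) * u 0)
    + ((n * m : ℤ) : ℂ) • (u (n + m + 1) * u (-1)) - ((m * (m + 1) : ℤ) : ℂ) • u (n + m)

theorem quadRel_one_one : quadRel 1 1 = Qe2 := by
  have h2 : ∀ x : 𝔘, (2 : 𝔘) * x = (2 : ℂ) • x := fun x => by
    rw [two_mul, two_smul]
  have h3 : ∀ x : 𝔘, (3 : 𝔘) * x = (3 : ℂ) • x := fun x => by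
    rw [← two_add_one_eq_three, add_mul, h2, one_mul]; module
  change _ = 3 * u 1 ^ 2 - 2 * u 2 * (2 * u 0 + 1) + u 3 * u (-1)
  simp only [h2, h3, mul_add, mul_one, mul_smul_comm, sq, quadRel]
  norm_num
  module

theorem quadRel_zero_right (n : ℤ) : quadRel n 0 = 0 := by
  simp [quadRel]

theorem quadRel_comm {n m : ℤ} (hn : -1 ≤ n) (hm : -1 ≤ m) : quadRel n m = quadRel m n := by
  have h : u n * u m = u m * u n + ((m - n : ℤ) : ℂ) • u (n + m) := by
    rw [← lie_u hn hm, Ring.lie_def]; abel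
  rw [quadRel, quadRel, h, add_comm m n]
  push_cast
  module

theorem lie_mul (x y z : 𝔘) : ⁅x, y * z⁆ = ⁅x, y⁆ * z + y * ⁅x, z⁆ := by
  simp only [Ring.lie_def]; noncomm_ring

/-- By the Leibniz rule, the bracket has four quadratic terms outside the shape `e k * e 0`, `e (k +
1) * e (-1)`, where `k = n + m + p`; each is the leading term of one relation on the right. The
factor `n + m + p + 1` is the leading coefficient of the relations of the new weight. The remaining
terms cancel. -/
theorem lie_quadRel {p n m : ℤ} (hp : 0 ≤ p) (hn : -1 ≤ n) (hm : -1 ≤ m) (hk : -1 ≤ n + m) :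
    ((n + m + p + 1 : ℤ) : ℂ) • ⁅u p, quadRel n m⁆ =
      (((n + m + 1) * (n - p) : ℤ) : ℂ) • quadRel (n + p) m
        + (((n + m + 1) * (m - p) : ℤ) : ℂ) • quadRel n (m + p)
        - (((p + 1) * (n * m) : ℤ) : ℂ) • quadRel (n + m + 1) (p - 1)
        + (((n + m + 1 + n * m) * p : ℤ) : ℂ) • quadRel (n + m) p := by
  have hp' : -1 ≤ p := by omega
  have hk' : -1 ≤ n + m + 1 := by omega
  unfold quadRel
  simp only [lie_add, lie_sub, lie_smul, lie_mul, lie_u hp' hn, lie_u hp' hm, lie_u hp' hk,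
    lie_u hp' hk', lie_u hp' (le_refl (-1)), lie_u hp' (show (-1 : ℤ) ≤ 0 by decide)]
  have e1 : n + p + m = n + m + p := by ring
  have e2 : n + (m + p) = n + m + p := by ring
  have e3 : n + m + 1 + (p - 1) = n + m + p := by ring
  have e4 : p + (n + m) = n + m + p := by ring
  have e5 : p + (n + m + 1) = n + m + p + 1 := by ring
  have e6 : p + -1 = p - 1 := by ring
  rw [e1, e2, e3, e4, e5, e6, add_comm p n, add_comm p m, add_zero]
  simp only [smul_mul_assoc, mul_smul_comm]
  push_cast
  module

/-! ### All relations of positive index lie in the ideal -/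

/-- The two-sided ideal generated by `Qe2`, as a subspace. -/
def idealQ : Submodule ℂ 𝔘 :=
  (TwoSidedIdeal.asIdeal (TwoSidedIdeal.span {Qe2})).restrictScalars ℂ

theorem mem_idealQ {x : 𝔘} : x ∈ idealQ ↔ x ∈ TwoSidedIdeal.span {Qe2} := Iff.rfl

theorem mul_mem_idealQ_left (x : 𝔘) {y : 𝔘} (hy : y ∈ idealQ) : x * y ∈ idealQ :=
  mem_idealQ.2 (TwoSidedIdeal.mul_mem_left _ x y (mem_idealQ.1 hy))

theorem mul_mem_idealQ_right {x : 𝔘} (y : 𝔘) (hx : x ∈ idealQ) : x * y ∈ idealQ :=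
  mem_idealQ.2 (TwoSidedIdeal.mul_mem_right _ x y (mem_idealQ.1 hx))

theorem lie_mem_idealQ (x : 𝔘) {y : 𝔘} (hy : y ∈ idealQ) : ⁅x, y⁆ ∈ idealQ := by
  rw [Ring.lie_def]
  exact sub_mem (mul_mem_idealQ_left x hy) (mul_mem_idealQ_right x hy)

theorem quadRel_one_one_mem : quadRel 1 1 ∈ idealQ := by
  rw [quadRel_one_one]
  exact TwoSidedIdeal.subset_span rfl

theorem mem_of_intCast_smul_mem {c : ℤ} (hc : c ≠ 0) {x : 𝔘} (h : (c : ℂ) • x ∈ idealQ) :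
    x ∈ idealQ :=
  (Submodule.smul_mem_iff _ (Int.cast_ne_zero.2 hc)).1 h

/-- The element `⁅u 1, quadRel n m⁆` of the ideal in terms of the relations of the next weight. -/
theorem lie_one_quadRel_mem {n m : ℤ} (hn : 1 ≤ n) (hm : 1 ≤ m) (h : quadRel n m ∈ idealQ) :
    (((n + m + 1) * (n - 1) : ℤ) : ℂ) • quadRel (n + 1) m
        + (((n + m + 1) * (m - 1) : ℤ) : ℂ) • quadRel n (m + 1)
        + ((n + m + 1 + n * m : ℤ) : ℂ) • quadRel (n + m) 1 ∈ idealQ := by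
  have := Submodule.smul_mem _ ((n + m + 1 + 1 : ℤ) : ℂ) (lie_mem_idealQ (u 1) h)
  rwa [lie_quadRel (by omega) (by omega) (by omega) (by omega), sub_self, quadRel_zero_right,
    smul_zero, sub_zero, mul_one] at this

/-- For `m = 1`, bracketing with `e 1` leaves only a multiple of `quadRel (n + 1) 1`, with
coefficient `n * (n + 3)` for `n ≥ 1`. -/
theorem quadRel_natCast_one_mem (n : ℕ) : quadRel (n + 1) 1 ∈ idealQ := by
  induction n with
  | zero => simpa using quadRel_one_one_mem
  | succ n ih =>
    have h := lie_one_quadRel_mem (by omega) le_rfl ih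
    rw [sub_self, mul_zero, Int.cast_zero, zero_smul, add_zero, ← add_smul, ← Int.cast_add] at h
    push_cast
    refine mem_of_intCast_smul_mem (ne_of_gt ?_) h
    have : (n : ℤ) + 1 - 1 = n := by ring
    rw [this]
    positivity

theorem quadRel_one_mem {n : ℤ} (hn : 1 ≤ n) : quadRel n 1 ∈ idealQ := by
  obtain ⟨k, rfl⟩ : ∃ k : ℕ, n = k + 1 := ⟨(n - 1).toNat, by omega⟩
  exact quadRel_natCast_one_mem k

/-- Bracketing `quadRel n 1` with `e 1` cannot raise the second index, since the coefficient `m - 1`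
vanishes there. The bracket of `e 2` with `quadRel n 1` supplies a second equation of the same
weight. -/
theorem quadRel_natCast_two_mem (n : ℕ) : quadRel (n + 1) 2 ∈ idealQ := by
  induction n with
  | zero =>
    rw [quadRel_comm (by simp) (by simp)]
    exact quadRel_one_mem (by norm_num)
  | succ n ih =>
    have h1 := lie_one_quadRel_mem (by omega) (by norm_num) ih
    have h2 := Submodule.smul_mem _ ((((n : ℤ) + 1) + 1 + 2 + 1 : ℤ) : ℂ)
      (lie_mem_idealQ (u 2) (quadRel_one_mem (show (1 : ℤ) ≤ n + 1 by omega)))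
    rw [lie_quadRel (by omega) (by omega) (by omega) (by omega)] at h2
    have a1 : quadRel (n + 1 + 2) 1 ∈ idealQ := quadRel_one_mem (by omega)
    have a2 : quadRel (n + 1 + 1 + 1) (2 - 1) ∈ idealQ := quadRel_one_mem (by omega)
    -- The weights `n + 3` and `n + 4` eliminate `quadRel (n + 1) 3`; apart from relations with
    -- second index `1`, only `quadRel (n + 2) 2` survives, with positive coefficient.
    have h3 := add_mem (Submodule.smul_mem _ ((n + 3 : ℤ) : ℂ) h1)
      (Submodule.smul_mem _ ((n + 4 : ℤ) : ℂ) h2)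
    have h4 := add_mem (sub_mem h3 (Submodule.smul_mem _ ((((n + 3) * ((n + 1) + 2 + 1 + (n + 1) * 2)
      + (n + 4) * ((n + 1 + 1 + 1) * (n + 1 - 2)) : ℤ)) : ℂ) a1))
      (Submodule.smul_mem _ (((n + 4) * (3 * (n + 1)) : ℤ) : ℂ) a2)
    refine mem_of_intCast_smul_mem (c := (n + 3) * (n + 4) * n
      + (n + 4) * ((2 * n + 4) * 2)) (by positivity) ?_
    convert h4 using 1
    rw [show (1 + 2 : ℤ) = 2 + 1 by norm_num]
    push_cast
    module

theorem quadRel_natCast_mem (m n : ℕ) : quadRel (n + 1) (m + 1) ∈ idealQ := by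
  induction m generalizing n with
  | zero => simpa using quadRel_natCast_one_mem n
  | succ m ih =>
    rcases m with _ | m
    · exact_mod_cast quadRel_natCast_two_mem n
    -- From second index `m + 2` on, the coefficient `m + 1` of the unknown relation is nonzero, and
    -- the other two relations are already in the ideal.
    · have h := lie_one_quadRel_mem (by omega) (by omega) (ih n)
      have a1 := ih (n + 1)
      have a2 : quadRel (n + 1 + ((m + 1 : ℕ) + 1)) 1 ∈ idealQ := quadRel_one_mem (by omega)
      push_cast at h a1 a2 ⊢
      refine mem_of_intCast_smul_mem
        (c := (n + 1 + (m + 1 + 1) + 1) * (m + 1 + 1 - 1)) (by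
          have : (m + 1 + 1 - 1 : ℤ) = m + 1 := by ring
          rw [this]; positivity) ?_
      have h := (Submodule.add_mem_iff_left _ (Submodule.smul_mem _ _ a2)).1 h
      have h := (Submodule.add_mem_iff_right _ (Submodule.smul_mem _ _ a1)).1 h
      exact_mod_cast h

theorem quadRel_mem {n m : ℤ} (hn : 1 ≤ n) (hm : 1 ≤ m) : quadRel n m ∈ idealQ := by
  obtain ⟨k, rfl⟩ : ∃ k : ℕ, n = k + 1 := ⟨(n - 1).toNat, by omega⟩
  obtain ⟨l, rfl⟩ : ∃ l : ℕ, m = l + 1 := ⟨(m - 1).toNat, by omega⟩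
  exact quadRel_natCast_mem l k

/-! ### Standard monomials span modulo the ideal -/

/-- A universal enveloping algebra is generated by its Lie algebra. -/
theorem adjoin_range_ι (R L : Type*) [CommRing R] [LieRing L] [LieAlgebra R L] :
    Algebra.adjoin R (Set.range (UniversalEnvelopingAlgebra.ι R (L := L))) = ⊤ := by
  set S := Algebra.adjoin R (Set.range (UniversalEnvelopingAlgebra.ι R (L := L))) with hS
  let f : L →ₗ⁅R⁆ S :=
    { toFun := fun x => ⟨UniversalEnvelopingAlgebra.ι R x, Algebra.subset_adjoin ⟨x, rfl⟩⟩
      map_add' := fun x y => Subtype.ext (map_add _ x y)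
      map_smul' := fun c x => Subtype.ext (map_smul _ c x)
      map_lie' := fun {x y} => Subtype.ext (LieHom.map_lie _ x y) }
  -- By the universal property, the identity factors through the subalgebra `S`.
  have h : S.val.comp (UniversalEnvelopingAlgebra.lift R f) = AlgHom.id R _ := by
    apply UniversalEnvelopingAlgebra.hom_ext
    ext x
    simp [f]
  rw [eq_top_iff]
  intro x _
  have hx := congrArg (fun g => g x) h
  simp only [AlgHom.comp_apply, AlgHom.id_apply] at hx
  rw [← hx]
  exact (UniversalEnvelopingAlgebra.lift R f x).2

/-- The subspace spanned by the products `e 0 ^ j * e (-1) ^ i`. -/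
def borel : Submodule ℂ 𝔘 :=
  Submodule.span ℂ (Set.range fun a : ℂ[X] × ℕ => aeval (u 0) a.1 * u (-1) ^ a.2)

theorem aeval_mul_pow_mem_borel (p : ℂ[X]) (i : ℕ) : aeval (u 0) p * u (-1) ^ i ∈ borel :=
  Submodule.subset_span ⟨(p, i), rfl⟩

theorem one_mem_borel : (1 : 𝔘) ∈ borel := by
  simpa using aeval_mul_pow_mem_borel 1 0

theorem u_neg_one_mul_aeval (p : ℂ[X]) :
    u (-1) * aeval (u 0) p = aeval (u 0) (p.comp (X + 1)) * u (-1) := by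
  have h : SemiconjBy (u (-1)) (u 0) (u 0 + 1) := by
    have := lie_u (le_refl (-1)) (show (-1 : ℤ) ≤ 0 by decide)
    rw [Ring.lie_def] at this
    rw [SemiconjBy, add_mul, one_mul, ← sub_eq_iff_eq_add', this]
    simp
  induction p using Polynomial.induction_on' with
  | add p q hp hq => simp [mul_add, add_mul, hp, hq]
  | monomial n c =>
    simp only [aeval_monomial, monomial_comp, map_mul, aeval_C, map_pow, map_add, aeval_X, map_one]
    rw [Algebra.left_comm, (h.pow_right n).eq, mul_assoc]

theorem span_mul_left_mem {s : Set 𝔘} {S : Submodule ℂ 𝔘} {x : 𝔘} (h : ∀ y ∈ s, x * y ∈ S)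
    {y : 𝔘} (hy : y ∈ Submodule.span ℂ s) : x * y ∈ S :=
  (Submodule.span_le.2 h : Submodule.span ℂ s ≤ S.comap (LinearMap.mulLeft ℂ x)) hy

theorem u_zero_mul_mem_borel {b : 𝔘} (hb : b ∈ borel) : u 0 * b ∈ borel := by
  refine span_mul_left_mem ?_ hb
  rintro _ ⟨⟨p, i⟩, rfl⟩
  have := aeval_mul_pow_mem_borel (X * p) i
  rwa [map_mul, aeval_X, mul_assoc] at this

theorem u_neg_one_mul_mem_borel {b : 𝔘} (hb : b ∈ borel) : u (-1) * b ∈ borel := by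
  refine span_mul_left_mem ?_ hb
  rintro _ ⟨⟨p, i⟩, rfl⟩
  simpa [← mul_assoc, u_neg_one_mul_aeval, pow_succ'] using
    aeval_mul_pow_mem_borel (p.comp (X + 1)) (i + 1)

/-- The leading factors `1, e 1, e 2, …` of the standard monomials. -/
def lead (n : ℕ) : 𝔘 := if n = 0 then 1 else u n

/-- The span of the standard monomials modulo the ideal generated by `Qe2`. -/
def standardSpan : Submodule ℂ 𝔘 :=
  idealQ ⊔ Submodule.span ℂ {x | ∃ n : ℕ, ∃ b ∈ borel, lead n * b = x}

theorem lead_mul_mem (n : ℕ) {b : 𝔘} (hb : b ∈ borel) : lead n * b ∈ standardSpan :=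
  Submodule.mem_sup_right (Submodule.subset_span ⟨n, b, hb, rfl⟩)

theorem u_mul_borel_mem {p : ℤ} (hp : -1 ≤ p) {b : 𝔘} (hb : b ∈ borel) :
    u p * b ∈ standardSpan := by
  have h0 : ∀ {b : 𝔘}, b ∈ borel → b ∈ standardSpan := fun {b} hb => by
    simpa [lead] using lead_mul_mem 0 hb
  rcases lt_trichotomy p 0 with h | rfl | h
  · obtain rfl : p = -1 := by omega
    exact h0 (u_neg_one_mul_mem_borel hb)
  · exact h0 (u_zero_mul_mem_borel hb)
  · lift p to ℕ using h.le
    have := lead_mul_mem p hb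
    rwa [lead, if_neg (by omega)] at this

/-- For `p ≥ 1`, `quadRel p n` trades the product for terms with one positive-index factor, since
its leading coefficient `p + n + 1` is nonzero. For `p ≤ 0`, `u p` is commuted past `u n` and
absorbed into `borel`. -/
theorem u_mul_u_mul_borel_mem {p n : ℤ} (hp : -1 ≤ p) (hn : 1 ≤ n) {b : 𝔘} (hb : b ∈ borel) :
    u p * (u n * b) ∈ standardSpan := by
  by_cases h1 : 1 ≤ p
  · have hc : ((p + n + 1 : ℤ) : ℂ) ≠ 0 := Int.cast_ne_zero.2 (by omega)
    rw [← Submodule.smul_mem_iff _ hc]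
    have hq : quadRel p n * b ∈ standardSpan :=
      Submodule.mem_sup_left (mul_mem_idealQ_right b (quadRel_mem h1 hn))
    have a1 := u_mul_borel_mem (show -1 ≤ p + n by omega) (u_zero_mul_mem_borel hb)
    have a2 := u_mul_borel_mem (show -1 ≤ p + n + 1 by omega) (u_neg_one_mul_mem_borel hb)
    have a3 := u_mul_borel_mem (show -1 ≤ p + n by omega) hb
    convert add_mem (sub_mem (add_mem hq (Submodule.smul_mem _ ((p + n + 1 + p * n : ℤ) : ℂ) a1))
      (Submodule.smul_mem _ ((p * n : ℤ) : ℂ) a2))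
      (Submodule.smul_mem _ ((n * (n + 1) : ℤ) : ℂ) a3) using 1
    simp only [quadRel, sub_mul, add_mul, smul_mul_assoc, mul_assoc]
    module
  · have h : u p * (u n * b) = u n * (u p * b) + ((n - p : ℤ) : ℂ) • (u (p + n) * b) := by
      rw [← smul_mul_assoc, ← lie_u hp (by omega), Ring.lie_def]
      noncomm_ring
    rw [h]
    refine add_mem (u_mul_borel_mem (by omega) ?_)
      (Submodule.smul_mem _ _ (u_mul_borel_mem (by omega) hb))
    obtain rfl | rfl : p = -1 ∨ p = 0 := by omega
    · exact u_neg_one_mul_mem_borel hb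
    · exact u_zero_mul_mem_borel hb

theorem u_mul_mem {p : ℤ} (hp : -1 ≤ p) {x : 𝔘} (hx : x ∈ standardSpan) :
    u p * x ∈ standardSpan := by
  obtain ⟨y, hy, z, hz, rfl⟩ := Submodule.mem_sup.1 hx
  rw [mul_add]
  refine add_mem (Submodule.mem_sup_left (mul_mem_idealQ_left _ hy)) (span_mul_left_mem ?_ hz)
  rintro _ ⟨n, b, hb, rfl⟩
  by_cases hn : n = 0
  · simpa [lead, hn] using u_mul_borel_mem hp hb
  · simpa [lead, hn] using u_mul_u_mul_borel_mem hp (show (1 : ℤ) ≤ n by omega) hb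

theorem ι_mul_mem (D : Vec) {x : 𝔘} (hx : x ∈ standardSpan) :
    UniversalEnvelopingAlgebra.ι ℂ D * x ∈ standardSpan := by
  rw [← field_coeff D]
  induction coeff D using Polynomial.induction_on' with
  | add p q hp hq =>
    rw [field, map_add, map_add, add_mul]
    exact add_mem hp hq
  | monomial n c =>
    have h : field (monomial n c) = c • e (n - 1) := by
      simp [field, e, ← map_smul, smul_X_eq_monomial]
    rw [h, map_smul, smul_mul_assoc]
    exact Submodule.smul_mem _ _ (u_mul_mem (by omega) hx)

theorem standardSpan_eq_top : standardSpan = ⊤ := by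
  rw [eq_top_iff]
  rintro x -
  -- The span contains `1`, so stability under left multiplication by generators suffices.
  have key : ∀ y ∈ standardSpan, x * y ∈ standardSpan := by
    have hx : x ∈ Algebra.adjoin ℂ (Set.range (UniversalEnvelopingAlgebra.ι ℂ (L := Vec))) := by
      rw [adjoin_range_ι]; trivial
    induction hx using Algebra.adjoin_induction with
    | mem x hx => obtain ⟨D, rfl⟩ := hx; exact fun y => ι_mul_mem D
    | algebraMap c =>
      intro y hy
      rw [← Algebra.smul_def]
      exact Submodule.smul_mem _ _ hy
    | add a b _ _ ha hb => intro y hy; rw [add_mul]; exact add_mem (ha y hy) (hb y hy)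
    | mul a b _ _ ha hb => intro y hy; rw [mul_assoc]; exact ha _ (hb y hy)
  simpa [lead] using key _ (lead_mul_mem 0 one_mem_borel)

/-- The standard monomials `lead n * p (e 0) * e (-1) ^ i`, as linear functions of `p`. -/
def monomialMap (a : ℕ × ℕ) : ℂ[X] →ₗ[ℂ] 𝔘 :=
  LinearMap.mulLeft ℂ (lead a.1) ∘ₗ LinearMap.mulRight ℂ (u (-1) ^ a.2) ∘ₗ
    (aeval (u 0)).toLinearMap

theorem monomialMap_apply (a : ℕ × ℕ) (p : ℂ[X]) :
    monomialMap a p = lead a.1 * (aeval (u 0) p * u (-1) ^ a.2) := rfl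

/-- Linear combinations of standard monomials. -/
def normalForm : (ℕ × ℕ →₀ ℂ[X]) →ₗ[ℂ] 𝔘 := Finsupp.lsum ℂ monomialMap

theorem exists_sub_normalForm_mem (x : 𝔘) : ∃ q, x - normalForm q ∈ idealQ := by
  have hx : x ∈ standardSpan := standardSpan_eq_top ▸ Submodule.mem_top
  obtain ⟨y, hy, z, hz, rfl⟩ := Submodule.mem_sup.1 hx
  have : z ∈ LinearMap.range normalForm := by
    refine Submodule.span_le.2 ?_ hz
    rintro _ ⟨n, b, hb, rfl⟩
    refine span_mul_left_mem ?_ hb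
    rintro _ ⟨⟨p, i⟩, rfl⟩
    exact ⟨Finsupp.single (n, i) p, by simp [normalForm, monomialMap_apply]⟩
  obtain ⟨q, rfl⟩ := this
  exact ⟨q, by simpa using hy⟩

/-! ### Independence of standard monomials in the tensor density modules -/

/-- The action of `𝔘` on the tensor density module `𝓕_lam`. -/
abbrev act (lam : ℂ) : 𝔘 →ₐ[ℂ] Module.End ℂ ℂ[X] :=
  UniversalEnvelopingAlgebra.lift ℂ (tensorDensity lam)

theorem act_u (lam : ℂ) (n : ℤ) (g : ℂ[X]) :
    act lam (u n) g = X ^ (n + 1).toNat * derivative g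
      + lam • (derivative (X ^ (n + 1).toNat) * g) := by
  rw [act, u, UniversalEnvelopingAlgebra.lift_ι_apply, e, tensorDensity_field]

theorem act_u_neg_one (lam : ℂ) : act lam (u (-1)) = derivative := by
  apply LinearMap.ext
  intro g
  simp [act_u]

theorem act_aeval_one (lam : ℂ) (p : ℂ[X]) : act lam (aeval (u 0) p) 1 = C (p.eval lam) := by
  induction p using Polynomial.induction_on' with
  | add p q hp hq => simp [hp, hq]
  | monomial n c =>
    have h : ∀ n : ℕ, ((act lam (u 0)) ^ n) 1 = C (lam ^ n) := by
      intro n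
      induction n with
      | zero => simp
      | succ n ih =>
        rw [pow_succ', Module.End.mul_apply, ih, act_u]
        simp [smul_eq_C_mul, pow_succ']
    simp [aeval_monomial, h, ← Algebra.smul_def, smul_eq_C_mul]

theorem act_lead_C (lam : ℂ) (n : ℕ) (c : ℂ) :
    act lam (lead n) (C c) = C ((if n = 0 then 1 else (n + 1) * lam) * c) * X ^ n := by
  by_cases hn : n = 0
  · simp [lead, hn]
  · rw [lead, if_neg hn, if_neg hn, act_u]
    have : ((n : ℤ) + 1).toNat = n + 1 := by omega
    rw [this]
    simp [smul_eq_C_mul]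
    ring

theorem act_monomialMap_of_lt (lam : ℂ) {n i l : ℕ} (h : l < i) (p : ℂ[X]) :
    act lam (monomialMap (n, i) p) (X ^ l) = 0 := by
  have : ((derivative : Module.End ℂ ℂ[X]) ^ i) (X ^ l) = 0 := by
    rw [Module.End.pow_apply]
    exact iterate_derivative_eq_zero (by simpa using h)
  simp [monomialMap_apply, act_u_neg_one, this]

/-- Here `e (-1) ^ l` reduces `X ^ l` to the constant `l!`, on which `e 0` acts by `lam`; then `lead
n` moves the result to degree `n`. -/
theorem act_monomialMap_self (lam : ℂ) (n l : ℕ) (p : ℂ[X]) :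
    act lam (monomialMap (n, l) p) (X ^ l) =
      C ((if n = 0 then 1 else (n + 1) * lam) * (l.factorial * p.eval lam)) * X ^ n := by
  have : ((derivative : Module.End ℂ ℂ[X]) ^ l) (X ^ l) = (l.factorial : ℂ) • 1 := by
    rw [Module.End.pow_apply, iterate_derivative_X_pow_eq_smul]
    simp [Nat.descFactorial_self, smul_eq_C_mul]
  simp only [monomialMap_apply, map_mul, map_pow, act_u_neg_one, Module.End.mul_apply, this,
    map_smul, act_aeval_one]
  rw [smul_eq_C_mul, ← C_mul, act_lead_C, ← mul_assoc, ← C_mul, mul_left_comm, C_mul]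

/-- The system is triangular: on `X ^ l`, terms with `i > l` vanish and those with `i < l` are zero
by induction. The terms with `i = l` are separated by their degree `n`, leaving `p (lam)` up to a
factor that is nonzero for `lam ≠ 0`. -/
theorem eq_zero_of_act_normalForm_eq_zero {q : ℕ × ℕ →₀ ℂ[X]}
    (h : ∀ lam, act lam (normalForm q) = 0) : q = 0 := by
  suffices H : ∀ l n, q (n, l) = 0 from Finsupp.ext fun ⟨n, l⟩ => H l n
  intro l
  induction l using Nat.strong_induction_on with
  | _ l ih =>
  intro n
  have key : ∀ lam : ℂ,
      (if n = 0 then 1 else ((n : ℂ) + 1) * lam) * (l.factorial * (q (n, l)).eval lam) = 0 := by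
    intro lam
    have h1 : (act lam (normalForm q) (X ^ l)).coeff n = 0 := by rw [h]; simp
    rw [normalForm, Finsupp.lsum_apply, Finsupp.sum, map_sum, LinearMap.sum_apply,
      finsetSum_coeff, Finset.sum_eq_single (n, l)] at h1
    · rw [act_monomialMap_self] at h1
      simpa using h1
    · rintro ⟨m, i⟩ - hne
      rcases lt_trichotomy i l with hi | rfl | hi
      · simp [ih i hi m]
      · rw [act_monomialMap_self, coeff_C_mul_X_pow, if_neg]
        rintro rfl
        exact hne rfl
      · rw [act_monomialMap_of_lt lam hi, coeff_zero]
    · intro hn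
      simp [Finsupp.notMem_support_iff.1 hn]
  -- For `n ≥ 1` nothing is known at `lam = 0`; multiplying by `X` makes the value there vanish
  -- anyway.
  have hX : X * q (n, l) = 0 := by
    apply Polynomial.funext
    intro lam
    rcases eq_or_ne lam 0 with rfl | hlam
    · simp
    · have hc : (if n = 0 then 1 else ((n : ℂ) + 1) * lam) ≠ 0 := by
        split_ifs
        · exact one_ne_zero
        · exact mul_ne_zero n.cast_add_one_ne_zero hlam
      have := (mul_eq_zero.1 ((mul_eq_zero.1 (key lam)).resolve_left hc)).resolve_left
        (Nat.cast_ne_zero.2 l.factorial_ne_zero)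
      simp [this]
  simpa using hX

/-! ### The universal module and its specialisations -/

/-- The action of `𝔘` on the universal tensor density module `𝓕_Λ`. -/
abbrev universalAct : 𝔘 →ₐ[ℂ] Module.End ℂ ℂ[X][X] :=
  UniversalEnvelopingAlgebra.lift ℂ universalTensorDensity

theorem universalAct_u (n : ℤ) (g : ℂ[X][X]) :
    universalAct (u n) g = X ^ (n + 1).toNat * derivative g
      + C X * derivative (X ^ (n + 1).toNat) * g := by
  rw [universalAct, u, UniversalEnvelopingAlgebra.lift_ι_apply, e, universalTensorDensity_field,
    ← derivative_incl]
  simp [incl]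

theorem universalAct_Qe2 : universalAct Qe2 = 0 := by
  apply LinearMap.ext
  intro g
  have h : Qe2 = 3 * u 1 ^ 2 - 2 * u 2 * (2 * u 0 + 1) + u 3 * u (-1) := rfl
  have h2 : ∀ f : ℂ[X][X], (2 : Module.End ℂ ℂ[X][X]) f = 2 * f := fun f => by
    rw [← one_add_one_eq_two, LinearMap.add_apply, Module.End.one_apply]; ring
  have h3 : ∀ f : ℂ[X][X], (3 : Module.End ℂ ℂ[X][X]) f = 3 * f := fun f => by
    rw [← two_add_one_eq_three, LinearMap.add_apply, Module.End.one_apply, h2]; ring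
  rw [h]
  simp only [map_add, map_sub, map_mul, map_ofNat, map_one, sq, LinearMap.add_apply,
    LinearMap.sub_apply, Module.End.mul_apply, Module.End.one_apply, universalAct_u, h2, h3]
  simp only [show ((0 : ℤ) + 1).toNat = 1 from rfl, show ((1 : ℤ) + 1).toNat = 2 from rfl,
    show ((2 : ℤ) + 1).toNat = 3 from rfl, show ((3 : ℤ) + 1).toNat = 4 from rfl,
    show ((-1 : ℤ) + 1).toNat = 0 from rfl]
  norm_num [derivative_mul, derivative_X_pow]
  simp only [show (C 2 : ℂ[X][X]) = 2 from rfl, show (C 3 : ℂ[X][X]) = 3 from rfl,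
    show (C 4 : ℂ[X][X]) = 4 from rfl]
  ring

/-- Specialisation of `Λ` to `lam`. -/
def specialize (lam : ℂ) : ℂ[X][X] →+* ℂ[X] := mapRingHom (evalRingHom lam)

theorem specialize_incl (lam : ℂ) (f : ℂ[X]) : specialize lam (incl f) = f := by
  have : (evalRingHom lam).comp (algebraMap ℂ ℂ[X]) = RingHom.id ℂ := by ext; simp
  simp only [specialize, incl, coe_mapRingHom, coe_mapAlgHom]
  change Polynomial.map (evalRingHom lam) (Polynomial.map (algebraMap ℂ ℂ[X]) f) = f
  rw [Polynomial.map_map, this, Polynomial.map_id]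

/-- Equivariance of specialisation need only be checked on generators of `𝔘`. -/
theorem specialize_universalAct (lam : ℂ) (x : 𝔘) (g : ℂ[X][X]) :
    specialize lam (universalAct x g) = act lam x (specialize lam g) := by
  have hx : x ∈ Algebra.adjoin ℂ (Set.range (UniversalEnvelopingAlgebra.ι ℂ (L := Vec))) := by
    rw [adjoin_range_ι]; trivial
  induction hx using Algebra.adjoin_induction generalizing g with
  | mem x hx =>
    obtain ⟨D, rfl⟩ := hx
    rw [universalAct, act, UniversalEnvelopingAlgebra.lift_ι_apply,
      UniversalEnvelopingAlgebra.lift_ι_apply, ← field_coeff D, tensorDensity_field,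
      universalTensorDensity_field]
    simp only [map_add, map_mul, specialize_incl]
    simp [specialize, derivative_map, smul_eq_C_mul, mul_assoc]
  | algebraMap c =>
    simp only [AlgHom.commutes, Module.algebraMap_end_apply]
    have : c • g = C (C c) * g := by rw [← smul_eq_C_mul, ← algebraMap_eq, algebraMap_smul]
    rw [this, map_mul]
    simp [specialize, smul_eq_C_mul]
  | add a b _ _ ha hb => simp [ha, hb]
  | mul a b _ _ ha hb => simp [ha, hb]

theorem annihilator_universalTensorDensity_le :
    annihilator universalTensorDensity ≤ ⨅ lam, annihilator (tensorDensity lam) := by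
  intro x hx
  rw [TwoSidedIdeal.mem_iInf]
  intro lam
  have hx : universalAct x = 0 := (TwoSidedIdeal.mem_ker _).1 hx
  refine (TwoSidedIdeal.mem_ker _).2 (LinearMap.ext fun g => ?_)
  -- Every `g` is the specialisation of `incl g`, so specialisation is onto.
  have := specialize_universalAct lam x (incl g)
  rw [specialize_incl, hx] at this
  simpa using this.symm

theorem span_Qe2_le :
    TwoSidedIdeal.span {Qe2} ≤ annihilator universalTensorDensity := by
  rw [TwoSidedIdeal.span_le, Set.singleton_subset_iff]
  exact (TwoSidedIdeal.mem_ker _).2 universalAct_Qe2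

theorem iInf_annihilator_tensorDensity_le :
    ⨅ lam, annihilator (tensorDensity lam) ≤ TwoSidedIdeal.span {Qe2} := by
  intro x hx
  obtain ⟨q, hq⟩ := exists_sub_normalForm_mem x
  have hq0 : q = 0 := by
    apply eq_zero_of_act_normalForm_eq_zero
    intro lam
    -- The ideal acts by zero, so `normalForm q` acts as `x` does, that is, by zero.
    have h1 := (TwoSidedIdeal.mem_iInf _).1
      (annihilator_universalTensorDensity_le (span_Qe2_le (mem_idealQ.1 hq))) lam
    have h2 := (TwoSidedIdeal.mem_iInf _).1 hx lam
    have h3 := TwoSidedIdeal.sub_mem _ h2 h1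
    rw [sub_sub_cancel] at h3
    exact (TwoSidedIdeal.mem_ker _).1 h3
  rwa [hq0, map_zero, sub_zero] at hq

end VecLine

end

theorem mainTheorem2 :
    (⨅ lam : ℂ, VecLine.annihilator (VecLine.tensorDensity lam)) =
        TwoSidedIdeal.span {VecLine.Qe2} ∧
      VecLine.annihilator VecLine.universalTensorDensity =
        TwoSidedIdeal.span {VecLine.Qe2} :=
  ⟨le_antisymm VecLine.iInf_annihilator_tensorDensity_le
      (VecLine.span_Qe2_le.trans VecLine.annihilator_universalTensorDensity_le),
    le_antisymm (VecLine.annihilator_universalTensorDensity_le.trans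
      VecLine.iInf_annihilator_tensorDensity_le) VecLine.span_Qe2_le⟩
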